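/- Let $\mathbb K=\mathbb R$ or $\mathbb C$; germs are smooth if $\mathbb K=\mathbb R$ and holomorphic if $\mathbb K=\mathbb C$. A multigerm $h=\{h_1,\dots,h_r\}$ is a finite family of germs $h_i:(\mathbb K^n,x_i)\to(\mathbb K^p,0)$. Write $\theta(h)$ for the space of germs of vector fields along $h$ (one germ $(\mathbb K^n,x_i)\to\mathbb K^p$ for each branch), $\theta_n$ for the germs at the points $x_i$ of vector fields on the source (one for each branch), $\theta_p$ for the germs at $0$ of vector fields on the target, $th(\chi)=dh\circ\chi$ for $\chi\in\theta_n$, and $wh(\eta)=\eta\circ h$ for $\eta\in\theta_p$. Put $$T\mathcal A_eh=th(\theta_n)+wh(\theta_p),\qquad \mathcal A_e\text{-cod}(h)=\dim_{\mathbb K}\frac{\theta(h)}{T\mathcal A_eh},\qquad \mathrm{Lift}(h)=\{\eta\in\theta_p:\ wh(\eta)=th(\xi)\text{ for some }\xi\in\theta_n\}.$$ The multigerm $h$ is called stable if $T\mathcal A_eh=\theta(h)$. **Theorem.** Let $n\ge 3$, let $f:(\mathbb K^{n-2},S)\to(\mathbb K^{n-2},0)$ be a multigerm, and let $F(x,\lambda)=(f_\lambda(x),\lambda)$,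 $\lambda\in\mathbb K^2$, $f_0=f$, be a stable $2$-parameter unfolding of $f$, that is, a stable multigerm $F:(\mathbb K^n,S\times\{0\})\to(\mathbb K^n,0)$ of this form. Let $g:(\mathbb K^n,0)\to(\mathbb K^n,0)$ be the suspended cusp $$g(x_1,\dots,x_{n-2},y,z)=(x_1,\dots,x_{n-2},y,z^3+yz),$$ and let $\{F,g\}$, the cuspidal concatenation of $f$, be the multigerm whose branches are those of $F$ together with $g$ (on a separate copy of the source). Let $\mathcal O_{n-1}$ be the ring of function germs at $0$ in the variables $(x,z)=(x_1,\dots,x_{n-2},z)$. Then $$\mathcal A_e\text{-cod}(\{F,g\})=\dim_{\mathbb K}\frac{\mathcal O_{n-1}}{\{-z\,\eta_{n-1}(x,-3z^2,-2z^3)+\eta_n(x,-3z^2,-2z^3)\ :\ \eta=(\eta_1,\dots,\eta_n)\in\mathrm{Lift}(F)\}},$$ where both sides may be infinite. -/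

import Mathlib

open Filter Topology
open scoped ContDiff

/-- `h` is `C^∞` over `𝕜` on a neighbourhood of `x`.  For `𝕜 = ℝ` these are the smooth
functions near `x`; for `𝕜 = ℂ` (where one complex derivative on a neighbourhood already gives
analyticity in finite dimensions) they are the functions holomorphic near `x`. -/
def SmoothNear (𝕜 : Type*) [RCLike 𝕜] {E P : Type*} [NormedAddCommGroup E] [NormedSpace 𝕜 E]
    [NormedAddCommGroup P] [NormedSpace 𝕜 P] (h : E → P) (x : E) : Prop :=
  ∀ᶠ y in 𝓝 x, ContDiffAt 𝕜 ∞ h y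

namespace SmoothNear

variable {𝕜 : Type*} [RCLike 𝕜] {E P Q : Type*} [NormedAddCommGroup E] [NormedSpace 𝕜 E]
  [NormedAddCommGroup P] [NormedSpace 𝕜 P] [NormedAddCommGroup Q] [NormedSpace 𝕜 Q]

theorem contDiffAt {h : E → P} {x : E} (hh : SmoothNear 𝕜 h x) : ContDiffAt 𝕜 ∞ h x :=
  hh.self_of_nhds

theorem of_contDiff {h : E → P} (hh : ContDiff 𝕜 ∞ h) (x : E) : SmoothNear 𝕜 h x :=
  Eventually.of_forall fun _ => hh.contDiffAt

theorem comp {h : P → Q} {f : E → P} {x : E} (hh : SmoothNear 𝕜 h (f x))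
    (hf : SmoothNear 𝕜 f x) : SmoothNear 𝕜 (fun y => h (f y)) x := by
  filter_upwards [hf.contDiffAt.continuousAt.eventually hh, hf] with y h1 h2
  exact h1.comp y h2

theorem fderiv_apply {f : E → P} {χ : E → E} {x : E} (hf : SmoothNear 𝕜 f x)
    (hχ : SmoothNear 𝕜 χ x) : SmoothNear 𝕜 (fun y => fderiv 𝕜 f y (χ y)) x := by
  filter_upwards [hf, hχ] with y h1 h2
  exact (h1.fderiv_right (m := ∞) (by simp)).clm_apply h2

end SmoothNear

/-- The `𝕜`-vector space of germs at `x` of smooth (`𝕜 = ℝ`) or holomorphic (`𝕜 = ℂ`) maps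
`E → P`.  With `P = 𝕜` it is the local ring `𝒪_E` of function germs; with `P = E` it is the
space of germs at `x` of vector fields on `E`. -/
def smoothGerm (𝕜 : Type*) [RCLike 𝕜] {E : Type*} [NormedAddCommGroup E] [NormedSpace 𝕜 E]
    (x : E) (P : Type*) [NormedAddCommGroup P] [NormedSpace 𝕜 P] :
    Submodule 𝕜 (Germ (𝓝 x) P) where
  carrier := {φ | ∃ h : E → P, SmoothNear 𝕜 h x ∧ (h : Germ (𝓝 x) P) = φ}
  zero_mem' := ⟨0, SmoothNear.of_contDiff contDiff_const x, rfl⟩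
  add_mem' := by
    rintro _ _ ⟨a, ha, rfl⟩ ⟨b, hb, rfl⟩
    exact ⟨a + b, by filter_upwards [ha, hb] with y h1 h2 using h1.add h2, rfl⟩
  smul_mem' := by
    rintro c _ ⟨a, ha, rfl⟩
    exact ⟨c • a, by filter_upwards [ha] with y h1 using h1.const_smul c, rfl⟩

/-- A multigerm `{f_i}_{i ∈ ι}` with branches `f_i : (E, x_i) → (P, 0)`, given by
representatives of its branches; everything defined from it below depends only on the germs of
the branches.  Each branch has its own source `(E, x_i)`, so base points of different branches
are not compared. -/
structure MultiGerm (𝕜 : Type*) [RCLike 𝕜] (ι : Type) (E P : Type*)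
    [NormedAddCommGroup E] [NormedSpace 𝕜 E] [NormedAddCommGroup P] [NormedSpace 𝕜 P] where
  /-- the base point of a branch -/
  pt : ι → E
  /-- a representative of a branch -/
  branch : ι → E → P
  smooth : ∀ i, SmoothNear 𝕜 (branch i) (pt i)
  map_pt : ∀ i, branch i (pt i) = 0

namespace MultiGerm

variable {𝕜 : Type*} [RCLike 𝕜] {ι κ : Type} {E P : Type*}
  [NormedAddCommGroup E] [NormedSpace 𝕜 E] [NormedAddCommGroup P] [NormedSpace 𝕜 P]

theorem tendsto_branch (f : MultiGerm 𝕜 ι E P) (i : ι) :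
    Tendsto (f.branch i) (𝓝 (f.pt i)) (𝓝 0) := by
  have h := (f.smooth i).contDiffAt.continuousAt.tendsto
  rwa [f.map_pt i] at h

/-- `θ_n = θ_{E,S}`: germs at the base points of vector fields on the source. -/
abbrev sourceFields (f : MultiGerm 𝕜 ι E P) : Type _ :=
  ∀ i, smoothGerm 𝕜 (f.pt i) E

/-- `θ(f)`: germs at the base points of vector fields along `f`. -/
abbrev fieldsAlong (f : MultiGerm 𝕜 ι E P) : Type _ :=
  ∀ i, smoothGerm 𝕜 (f.pt i) P

/-- `tf : θ_n → θ(f)`, `χ ↦ df ∘ χ`. -/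
noncomputable def t (f : MultiGerm 𝕜 ι E P) : f.sourceFields →ₗ[𝕜] f.fieldsAlong where
  toFun χ i := ⟨Germ.map₂ (fun (A : E →L[𝕜] P) v => A v)
      (fderiv 𝕜 (f.branch i) : Germ (𝓝 (f.pt i)) (E →L[𝕜] P)) (χ i : Germ (𝓝 (f.pt i)) E), by
    obtain ⟨a, ha, h⟩ := (χ i).2
    rw [← h]
    exact ⟨_, (f.smooth i).fderiv_apply ha, rfl⟩⟩
  map_add' χ χ' := by
    ext i
    obtain ⟨a, _, h⟩ := (χ i).2
    obtain ⟨b, _, h'⟩ := (χ' i).2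
    simp only [Pi.add_apply, Submodule.coe_add, ← h, ← h']
    exact congrArg _ (funext fun y => map_add _ _ _)
  map_smul' c χ := by
    ext i
    obtain ⟨a, _, h⟩ := (χ i).2
    simp only [Pi.smul_apply, Submodule.coe_smul, ← h]
    exact congrArg _ (funext fun y => map_smul _ _ _)

/-- `wf : θ_p → θ(f)`, `η ↦ η ∘ f`. -/
noncomputable def w (f : MultiGerm 𝕜 ι E P) :
    smoothGerm 𝕜 (0 : P) P →ₗ[𝕜] f.fieldsAlong where
  toFun η i := ⟨(η : Germ (𝓝 (0 : P)) P).compTendsto (f.branch i) (f.tendsto_branch i), by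
    obtain ⟨a, ha, h⟩ := η.2
    rw [← h]
    exact ⟨_, SmoothNear.comp (by rw [f.map_pt i]; exact ha) (f.smooth i), rfl⟩⟩
  map_add' η η' := by
    ext i
    obtain ⟨a, _, h⟩ := η.2
    obtain ⟨b, _, h'⟩ := η'.2
    simp only [Pi.add_apply, Submodule.coe_add, ← h, ← h']
    rfl
  map_smul' c η := by
    ext i
    obtain ⟨a, _, h⟩ := η.2
    simp only [Pi.smul_apply, Submodule.coe_smul, ← h]
    rfl

/-- The `𝒜_e`-tangent space `T𝒜_e f = tf(θ_n) + wf(θ_p)`. -/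
noncomputable def tangentAe (f : MultiGerm 𝕜 ι E P) : Submodule 𝕜 f.fieldsAlong :=
  LinearMap.range f.t ⊔ LinearMap.range f.w

/-- The `𝒜_e`-codimension `dim_𝕜 θ(f) / T𝒜_e f` (a cardinal, possibly infinite). -/
noncomputable def codimAe (f : MultiGerm 𝕜 ι E P) : Cardinal :=
  Module.rank 𝕜 (f.fieldsAlong ⧸ f.tangentAe)

/-- (Infinitesimal) stability: `T𝒜_e f = θ(f)`. -/
def IsStable (f : MultiGerm 𝕜 ι E P) : Prop :=
  f.tangentAe = ⊤

/-- `Lift(f)`: the germs at `0` of vector fields `η` on the target that are liftable over `f`,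
i.e. `wf(η) = tf(ξ)` for some `ξ ∈ θ_n`. -/
noncomputable def liftable (f : MultiGerm 𝕜 ι E P) : Submodule 𝕜 (smoothGerm 𝕜 (0 : P) P) :=
  (LinearMap.range f.t).comap f.w

/-- `F(x, l) = (f_l(x), l)` is an unfolding of `f = f_0` with parameter space `Λ`, based at
`S × {0}`. -/
def IsUnfoldingOf {Λ : Type*} [NormedAddCommGroup Λ] [NormedSpace 𝕜 Λ]
    (F : MultiGerm 𝕜 ι (E × Λ) (P × Λ)) (f : MultiGerm 𝕜 ι E P) : Prop :=
  ∀ i, F.pt i = (f.pt i, 0) ∧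
    (∀ᶠ q in 𝓝 (F.pt i), (F.branch i q).2 = q.2) ∧
    (∀ᶠ x in 𝓝 (f.pt i), (F.branch i (x, 0)).1 = f.branch i x)

/-- The multigerm `{f, g}` formed by the branches of `f` together with those of `g`. -/
def union (f : MultiGerm 𝕜 ι E P) (g : MultiGerm 𝕜 κ E P) : MultiGerm 𝕜 (ι ⊕ κ) E P where
  pt := Sum.elim f.pt g.pt
  branch := Sum.elim f.branch g.branch
  smooth := by rintro (i | i); exacts [f.smooth i, g.smooth i]
  map_pt := by rintro (i | i); exacts [f.map_pt i, g.map_pt i]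

end MultiGerm

/-- The suspended cusp `(x, y, z) ↦ (x, y, z³ + yz)`, a monogerm at the origin of
`𝕜^m × 𝕜 × 𝕜`. -/
def suspendedCusp (𝕜 : Type*) [RCLike 𝕜] (m : ℕ) :
    MultiGerm 𝕜 Unit ((Fin m → 𝕜) × 𝕜 × 𝕜) ((Fin m → 𝕜) × 𝕜 × 𝕜) where
  pt _ := 0
  branch _ q := (q.1, q.2.1, q.2.2 ^ 3 + q.2.1 * q.2.2)
  smooth _ := SmoothNear.of_contDiff (by fun_prop) _
  map_pt _ := by simp

/-- `(x, z) ↦ (x, -3z², -2z³)`, a parametrization of the discriminant of the suspended cusp. -/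
def cuspCurve (𝕜 : Type*) [RCLike 𝕜] (m : ℕ) (q : (Fin m → 𝕜) × 𝕜) : (Fin m → 𝕜) × 𝕜 × 𝕜 :=
  (q.1, -3 * q.2 ^ 2, -2 * q.2 ^ 3)

theorem contDiff_cuspCurve (𝕜 : Type*) [RCLike 𝕜] (m : ℕ) : ContDiff 𝕜 ∞ (cuspCurve 𝕜 m) := by
  unfold cuspCurve
  fun_prop

theorem cuspCurve_zero (𝕜 : Type*) [RCLike 𝕜] (m : ℕ) : cuspCurve 𝕜 m 0 = 0 := by
  simp [cuspCurve]

theorem tendsto_cuspCurve (𝕜 : Type*) [RCLike 𝕜] (m : ℕ) :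
    Tendsto (cuspCurve 𝕜 m) (𝓝 0) (𝓝 0) := by
  have h := (contDiff_cuspCurve 𝕜 m).continuous.tendsto 0
  rwa [cuspCurve_zero] at h

/-- The linear map sending a vector field germ `η = (η_1, …, η_n)` on `𝕜^n = 𝕜^m × 𝕜 × 𝕜` to
the function germ `(x, z) ↦ -z η_{n-1}(x, -3z², -2z³) + η_n(x, -3z², -2z³)` in `𝒪_{n-1}`. -/
noncomputable def cuspMap (𝕜 : Type*) [RCLike 𝕜] (m : ℕ) :
    smoothGerm 𝕜 (0 : (Fin m → 𝕜) × 𝕜 × 𝕜) ((Fin m → 𝕜) × 𝕜 × 𝕜) →ₗ[𝕜]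
      smoothGerm 𝕜 (0 : (Fin m → 𝕜) × 𝕜) 𝕜 where
  toFun η := ⟨Germ.map₂ (fun (q : (Fin m → 𝕜) × 𝕜) (v : (Fin m → 𝕜) × 𝕜 × 𝕜) =>
        -q.2 * v.2.1 + v.2.2)
      ((fun q => q : (Fin m → 𝕜) × 𝕜 → (Fin m → 𝕜) × 𝕜) :
        Germ (𝓝 (0 : (Fin m → 𝕜) × 𝕜)) ((Fin m → 𝕜) × 𝕜))
      ((η : Germ (𝓝 (0 : (Fin m → 𝕜) × 𝕜 × 𝕜)) ((Fin m → 𝕜) × 𝕜 × 𝕜)).compTendsto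
        (cuspCurve 𝕜 m) (tendsto_cuspCurve 𝕜 m)), by
    obtain ⟨a, ha, h⟩ := η.2
    rw [← h]
    refine ⟨fun q => -q.2 * (a (cuspCurve 𝕜 m q)).2.1 + (a (cuspCurve 𝕜 m q)).2.2, ?_, rfl⟩
    have hc : SmoothNear 𝕜 (fun q => a (cuspCurve 𝕜 m q)) (0 : (Fin m → 𝕜) × 𝕜) :=
      SmoothNear.comp (by rw [cuspCurve_zero]; exact ha)
        (SmoothNear.of_contDiff (contDiff_cuspCurve 𝕜 m) 0)
    filter_upwards [hc] with q hq
    exact (contDiffAt_snd.neg.mul hq.snd.fst).add hq.snd.snd⟩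
  map_add' η η' := by
    ext1
    obtain ⟨a, _, h⟩ := η.2
    obtain ⟨b, _, h'⟩ := η'.2
    simp only [Submodule.coe_add, ← h, ← h']
    refine congrArg _ (funext fun q => ?_)
    simp only [Function.comp_apply, Prod.fst_add, Prod.snd_add]
    ring
  map_smul' c η := by
    ext1
    obtain ⟨a, _, h⟩ := η.2
    simp only [Submodule.coe_smul, ← h]
    refine congrArg _ (funext fun q => ?_)
    simp only [Function.comp_apply, Prod.smul_fst, Prod.smul_snd, smul_eq_mul,
      RingHom.id_apply]
    ring

/-! Both sides are the dimension of one quotient of θ(g). Since `F` is stable, every class in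
θ({F,g})/T𝒜_e{F,g} has a representative that vanishes on the branches of `F`. Such a field, equal to
b on g, is tangent exactly when b ∈ tg(θ_n) + wg(Lift(F)), because the target field η used must be
cancelled over `F` by a source field. The codimension is therefore dim θ(g)/(tg(θ_n) + wg(Lift(F))).
It remains to identify θ(g)/tg(θ_n) with 𝒪_{n-1}. On the singular set y = -3z² the image of dg is
the kernel of the covector (0, -z, 1), so b ↦ -z b_{n-1} + b_n restricted to that set kills tg(θ_n).
By Hadamard's lemma its kernel is no larger (`ker_cuspFieldMap`). As g sends (x, -3z², z) to (x,
-3z², -2z³), this map turns wg(η) into `cuspMap` of η. -/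

/-! ### Parametric integrals and Hadamard's lemma -/

section ParametricIntegral

universe u

variable {𝕜 : Type u} [RCLike 𝕜] {E : Type u} [NormedAddCommGroup E] [NormedSpace 𝕜 E]
  [LocallyCompactSpace E]

/-- Differentiation under the integral sign for `x ↦ ∫₀¹ L_t (φ (T_t x)) dt`, where `T_t`
preserves the domain of `φ`. -/
theorem hasFDerivAt_integral_clm_comp {Q P : Type u} [NormedAddCommGroup Q] [NormedSpace 𝕜 Q]
    [NormedAddCommGroup P] [NormedSpace 𝕜 P] [NormedSpace ℝ P] [SMulCommClass 𝕜 ℝ P]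
    {U : Set E} (hU : IsOpen U) {T : ℝ → E →L[𝕜] E} (hT : Continuous T)
    (hTU : ∀ t ∈ Set.Icc (0 : ℝ) 1, ∀ x ∈ U, T t x ∈ U)
    {L : ℝ → Q →L[𝕜] P} (hL : Continuous L) {φ : E → Q} (hφ : ContDiffOn 𝕜 ∞ φ U)
    {x₀ : E} (hx₀ : x₀ ∈ U) :
    HasFDerivAt (fun x => ∫ t in (0 : ℝ)..1, L t (φ (T t x)))
      (∫ t in (0 : ℝ)..1, ((L t).comp (fderiv 𝕜 φ (T t x₀))).comp (T t)) x₀ := by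
  have hIoc : Set.uIoc (0 : ℝ) 1 ⊆ Set.Icc 0 1 := by
    rw [Set.uIoc_of_le zero_le_one]
    exact Set.Ioc_subset_Icc_self
  have hIcc : Set.uIcc (0 : ℝ) 1 = Set.Icc 0 1 := Set.uIcc_of_le zero_le_one
  have hmaps : Set.MapsTo (fun p : E × ℝ => T p.2 p.1) (U ×ˢ Set.Icc 0 1) U :=
    fun p hp => hTU p.2 hp.2 p.1 hp.1
  have hTc : Continuous fun p : E × ℝ => T p.2 p.1 :=
    (hT.comp continuous_snd).clm_apply continuous_fst
  have hF : ContinuousOn (fun p : E × ℝ => L p.2 (φ (T p.2 p.1))) (U ×ˢ Set.Icc 0 1) :=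
    (hL.comp continuous_snd).continuousOn.clm_apply
      (hφ.continuousOn.comp hTc.continuousOn hmaps)
  have hF' : ContinuousOn
      (fun p : E × ℝ => ((L p.2).comp (fderiv 𝕜 φ (T p.2 p.1))).comp (T p.2))
      (U ×ˢ Set.Icc 0 1) :=
    ((hL.comp continuous_snd).continuousOn.clm_comp
      ((hφ.continuousOn_fderiv_of_isOpen hU (by simp)).comp hTc.continuousOn hmaps)).clm_comp
      (hT.comp continuous_snd).continuousOn
  have slice : ∀ {Z : Type u} [TopologicalSpace Z] {G : E × ℝ → Z},
      ContinuousOn G (U ×ˢ Set.Icc 0 1) → ∀ x ∈ U,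
      ContinuousOn (fun t => G (x, t)) (Set.Icc 0 1) := fun hG x hx =>
    hG.comp (Continuous.prodMk_right x).continuousOn fun t ht => ⟨hx, ht⟩
  have meas : ∀ {Z : Type u} [NormedAddCommGroup Z] {f : ℝ → Z},
      ContinuousOn f (Set.Icc 0 1) → MeasureTheory.AEStronglyMeasurable f
        (MeasureTheory.volume.restrict (Set.uIoc 0 1)) := fun hf =>
    (hf.aestronglyMeasurable_of_isCompact isCompact_Icc measurableSet_Icc).mono_measure
      (MeasureTheory.Measure.restrict_mono_set _ hIoc)
  -- A compact neighbourhood of `x₀`, times [0, 1], gives a constant dominating the derivative.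
  obtain ⟨K, hK, hxK, hKU⟩ := exists_compact_subset hU hx₀
  obtain ⟨C, hC⟩ := (hK.prod (isCompact_Icc (a := (0 : ℝ)) (b := 1))).exists_bound_of_continuousOn
    (hF'.mono (Set.prod_mono hKU le_rfl))
  refine intervalIntegral.hasFDerivAt_integral_of_dominated_of_fderiv_le
    (F' := fun x t => ((L t).comp (fderiv 𝕜 φ (T t x))).comp (T t))
    (bound := fun _ => C) (mem_interior_iff_mem_nhds.1 hxK)
    ?_ ?_ ?_ ?_ ?_ ?_
  · filter_upwards [hU.mem_nhds hx₀] with x hx using meas (slice hF x hx)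
  · exact ContinuousOn.intervalIntegrable (by rw [hIcc]; exact slice hF x₀ hx₀)
  · exact meas (slice hF' x₀ hx₀)
  · exact Eventually.of_forall fun t ht x hx => hC (x, t) ⟨hx, hIoc ht⟩
  · exact intervalIntegrable_const
  · refine Eventually.of_forall fun t ht x hx => ?_
    have hd : HasFDerivAt φ (fderiv 𝕜 φ (T t x)) (T t x) :=
      ((hφ.differentiableOn (by simp)).differentiableAt
        (hU.mem_nhds (hTU t (hIoc ht) x (hKU hx)))).hasFDerivAt
    exact ((L t).hasFDerivAt.comp (T t x) hd).comp x (T t).hasFDerivAt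

/-- The derivative is again an integral of this form, with `φ` replaced by its derivative and `L t`
by A ↦ (L_t ∘ A) ∘ T_t. The induction therefore has to range over all `Q`, `P`, `L` and `φ`; a
single universe keeps the operator spaces in range. -/
theorem contDiffOn_integral_clm_comp {U : Set E} (hU : IsOpen U) {T : ℝ → E →L[𝕜] E}
    (hT : Continuous T) (hTU : ∀ t ∈ Set.Icc (0 : ℝ) 1, ∀ x ∈ U, T t x ∈ U) (n : ℕ) :
    ∀ {Q P : Type u} [NormedAddCommGroup Q] [NormedSpace 𝕜 Q]
    [NormedAddCommGroup P] [NormedSpace 𝕜 P] [NormedSpace ℝ P] [SMulCommClass 𝕜 ℝ P]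
    {L : ℝ → Q →L[𝕜] P} (_ : Continuous L) {φ : E → Q} (_ : ContDiffOn 𝕜 ∞ φ U),
    ContDiffOn 𝕜 n (fun x => ∫ t in (0 : ℝ)..1, L t (φ (T t x))) U := by
  induction n with
  | zero =>
    intro Q P _ _ _ _ _ _ L hL φ hφ
    exact contDiffOn_zero.2 fun x hx =>
      (hasFDerivAt_integral_clm_comp hU hT hTU hL hφ hx).continuousAt.continuousWithinAt
  | succ n ih =>
    intro Q P _ _ _ _ _ _ L hL φ hφ
    have hd := fun x hx => hasFDerivAt_integral_clm_comp (x₀ := x) hU hT hTU hL hφ hx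
    push_cast
    refine (contDiffOn_succ_iff_fderiv_of_isOpen hU).2
      ⟨fun x hx => (hd x hx).differentiableAt.differentiableWithinAt, by simp, ?_⟩
    have hL' : Continuous fun t => ((ContinuousLinearMap.compL 𝕜 E E P).flip (T t)).comp
        (ContinuousLinearMap.compL 𝕜 E Q P (L t)) :=
      ((ContinuousLinearMap.continuous _).comp hT).clm_comp
        ((ContinuousLinearMap.continuous _).comp hL)
    exact (ih hL' (hφ.fderiv_of_isOpen hU (by simp))).congr fun x hx => (hd x hx).fderiv

/-- Hadamard's lemma: a germ of functions on `X × 𝕜` vanishing on `X × {0}` is divisible by the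
last coordinate. -/
theorem SmoothNear.exists_eq_snd_mul {X : Type u} [NormedAddCommGroup X] [NormedSpace 𝕜 X]
    [LocallyCompactSpace X] {h : X × 𝕜 → 𝕜} (hh : SmoothNear 𝕜 h 0)
    (h0 : ∀ᶠ x in 𝓝 (0 : X), h (x, 0) = 0) :
    ∃ k : X × 𝕜 → 𝕜, SmoothNear 𝕜 k 0 ∧ ∀ᶠ p in 𝓝 (0 : X × 𝕜), h p = p.2 * k p := by
  obtain ⟨r, hr, hball⟩ := Metric.eventually_nhds_iff_ball.1 hh
  have hφ : ContDiffOn 𝕜 ∞ h (Metric.ball 0 r) := fun p hp => (hball p hp).contDiffWithinAt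
  -- Scaling the last coordinate by t ∈ [0, 1] preserves balls for the sup norm and joins (x, 0) to
  -- (x, s).
  let T : ℝ → X × 𝕜 →L[𝕜] X × 𝕜 := fun t =>
    (ContinuousLinearMap.inl 𝕜 X 𝕜).comp (ContinuousLinearMap.fst 𝕜 X 𝕜) +
      (t : 𝕜) • (ContinuousLinearMap.inr 𝕜 X 𝕜).comp (ContinuousLinearMap.snd 𝕜 X 𝕜)
  have hTapp : ∀ t p, T t p = (p.1, (t : 𝕜) * p.2) := fun t p => by
    simp [T]
  have hT : Continuous T :=
    continuous_const.add
      (Continuous.smul (f := fun t : ℝ => (t : 𝕜)) RCLike.continuous_ofReal continuous_const)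
  have hTU : ∀ t ∈ Set.Icc (0 : ℝ) 1, ∀ p ∈ Metric.ball (0 : X × 𝕜) r,
      T t p ∈ Metric.ball (0 : X × 𝕜) r := by
    intro t ht p hp
    rw [mem_ball_zero_iff] at hp ⊢
    refine lt_of_le_of_lt ?_ hp
    rw [hTapp, Prod.norm_mk, Prod.norm_def]
    refine max_le_max le_rfl ?_
    rw [norm_mul, RCLike.norm_ofReal, abs_of_nonneg ht.1]
    exact mul_le_of_le_one_left (norm_nonneg _) ht.2
  let k : X × 𝕜 → 𝕜 := fun p =>
    ∫ t in (0 : ℝ)..1, ContinuousLinearMap.apply 𝕜 𝕜 ((0, 1) : X × 𝕜) (fderiv 𝕜 h (T t p))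
  have hk : ContDiffOn 𝕜 ∞ k (Metric.ball 0 r) := contDiffOn_infty.2 fun n =>
    contDiffOn_integral_clm_comp Metric.isOpen_ball hT hTU n continuous_const
      (hφ.fderiv_of_isOpen Metric.isOpen_ball (by simp))
  have hbr : ∀ᶠ p in 𝓝 (0 : X × 𝕜), p ∈ Metric.ball (0 : X × 𝕜) r := Metric.ball_mem_nhds _ hr
  refine ⟨k, ?_, ?_⟩
  · filter_upwards [hbr] with p hp
    exact hk.contDiffAt (Metric.isOpen_ball.mem_nhds hp)
  · filter_upwards [hbr, continuousAt_fst.eventually h0] with p hp hp0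
    have hcont : ContinuousOn (fun t : ℝ => fderiv 𝕜 h (T t p) (0, 1)) (Set.uIcc 0 1) := by
      rw [Set.uIcc_of_le zero_le_one]
      refine ContinuousOn.clm_apply ?_ continuousOn_const
      exact (hφ.continuousOn_fderiv_of_isOpen Metric.isOpen_ball (by simp)).comp
        (hT.clm_apply continuous_const).continuousOn fun t ht => hTU t ht p hp
    have hder : ∀ t ∈ Set.uIcc (0 : ℝ) 1,
        HasDerivAt (fun t : ℝ => h (T t p)) (p.2 * fderiv 𝕜 h (T t p) (0, 1)) t := by
      intro t ht
      rw [Set.uIcc_of_le zero_le_one] at ht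
      have h1 : HasFDerivAt h (fderiv 𝕜 h (T t p)) (T t p) :=
        ((hball _ (hTU t ht p hp)).differentiableAt (by simp)).hasFDerivAt
      rw [hTapp] at h1 ⊢
      have h2 : HasDerivAt (fun s : 𝕜 => h (p.1, s)) (fderiv 𝕜 h (p.1, (t : 𝕜) * p.2) (0, 1))
          ((t : 𝕜) * p.2) :=
        h1.comp_hasDerivAt _ ((hasDerivAt_const _ _).prodMk (hasDerivAt_id _))
      have h3 : HasDerivAt (fun t : ℝ => (t : 𝕜) * p.2) p.2 t := by
        simpa using (RCLike.ofRealCLM (K := 𝕜)).hasDerivAt.mul_const p.2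
      -- The parameter t is real even when `𝕜` is ℂ, so the chain rule is applied over ℝ.
      have h4 := (h2.hasFDerivAt.restrictScalars ℝ).comp_hasDerivAt t h3
      simpa [hTapp, Function.comp_def] using h4
    have hint := intervalIntegral.integral_eq_sub_of_hasDerivAt hder
      (continuousOn_const.mul hcont).intervalIntegrable
    rw [intervalIntegral.integral_const_mul] at hint
    simp only [hTapp, RCLike.ofReal_one, one_mul, RCLike.ofReal_zero, zero_mul, hp0,
      sub_zero] at hint
    simp only [k, hTapp, ContinuousLinearMap.apply_apply]
    exact hint.symm

end ParametricIntegral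

/-! ### The quotient θ(g)/tg(θ_n) for the suspended cusp -/

section CuspTangent

variable {𝕜 : Type*} [RCLike 𝕜] {m : ℕ}

/-- `(x, z) ↦ (x, -3z², z)`, a parametrization of the singular set of the suspended cusp. -/
def cuspSingular (𝕜 : Type*) [RCLike 𝕜] (m : ℕ) (q : (Fin m → 𝕜) × 𝕜) :
    (Fin m → 𝕜) × 𝕜 × 𝕜 :=
  (q.1, -3 * q.2 ^ 2, q.2)

theorem contDiff_cuspSingular : ContDiff 𝕜 ∞ (cuspSingular 𝕜 m) := by
  unfold cuspSingular
  fun_prop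

theorem cuspSingular_zero : cuspSingular 𝕜 m 0 = 0 := by
  simp [cuspSingular]

theorem tendsto_cuspSingular : Tendsto (cuspSingular 𝕜 m) (𝓝 0) (𝓝 0) := by
  have h := (contDiff_cuspSingular (𝕜 := 𝕜) (m := m)).continuous.tendsto 0
  rwa [cuspSingular_zero] at h

theorem suspendedCusp_branch_cuspSingular (q : (Fin m → 𝕜) × 𝕜) :
    (suspendedCusp 𝕜 m).branch () (cuspSingular 𝕜 m q) = cuspCurve 𝕜 m q := by
  simp only [suspendedCusp, cuspSingular, cuspCurve, Prod.mk.injEq, true_and]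
  ring

theorem fderiv_suspendedCusp_apply (q v : (Fin m → 𝕜) × 𝕜 × 𝕜) :
    fderiv 𝕜 ((suspendedCusp 𝕜 m).branch ()) q v =
      (v.1, v.2.1, q.2.2 * v.2.1 + (3 * q.2.2 ^ 2 + q.2.1) * v.2.2) := by
  have hz : HasFDerivAt (fun q : (Fin m → 𝕜) × 𝕜 × 𝕜 => q.2.2) _ q :=
    (hasFDerivAt_snd (𝕜 := 𝕜)).comp q (hasFDerivAt_snd (𝕜 := 𝕜))
  have hy : HasFDerivAt (fun q : (Fin m → 𝕜) × 𝕜 × 𝕜 => q.2.1) _ q :=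
    (hasFDerivAt_fst (𝕜 := 𝕜)).comp q (hasFDerivAt_snd (𝕜 := 𝕜))
  have h : HasFDerivAt ((suspendedCusp 𝕜 m).branch ()) _ q :=
    (hasFDerivAt_fst (𝕜 := 𝕜)).prodMk (hy.prodMk ((hz.pow 3).add (hy.mul hz)))
  rw [h.fderiv]
  simp
  ring

/-- The linear map sending `b`, the germ of a vector field along the suspended cusp, to the
function germ `(x, z) ↦ -z b_{n-1}(x, -3z², z) + b_n(x, -3z², z)`. -/
noncomputable def cuspRestrict (𝕜 : Type*) [RCLike 𝕜] (m : ℕ) :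
    smoothGerm 𝕜 (0 : (Fin m → 𝕜) × 𝕜 × 𝕜) ((Fin m → 𝕜) × 𝕜 × 𝕜) →ₗ[𝕜]
      smoothGerm 𝕜 (0 : (Fin m → 𝕜) × 𝕜) 𝕜 where
  toFun b := ⟨Germ.map₂ (fun (q : (Fin m → 𝕜) × 𝕜) (v : (Fin m → 𝕜) × 𝕜 × 𝕜) =>
        -q.2 * v.2.1 + v.2.2)
      ((fun q => q : (Fin m → 𝕜) × 𝕜 → (Fin m → 𝕜) × 𝕜) :
        Germ (𝓝 (0 : (Fin m → 𝕜) × 𝕜)) ((Fin m → 𝕜) × 𝕜))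
      ((b : Germ (𝓝 (0 : (Fin m → 𝕜) × 𝕜 × 𝕜)) ((Fin m → 𝕜) × 𝕜 × 𝕜)).compTendsto
        (cuspSingular 𝕜 m) tendsto_cuspSingular), by
    obtain ⟨a, ha, h⟩ := b.2
    rw [← h]
    refine ⟨fun q => -q.2 * (a (cuspSingular 𝕜 m q)).2.1 + (a (cuspSingular 𝕜 m q)).2.2, ?_, rfl⟩
    have hc : SmoothNear 𝕜 (fun q => a (cuspSingular 𝕜 m q)) (0 : (Fin m → 𝕜) × 𝕜) :=
      SmoothNear.comp (by rw [cuspSingular_zero]; exact ha)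
        (SmoothNear.of_contDiff contDiff_cuspSingular 0)
    filter_upwards [hc] with q hq
    exact (contDiffAt_snd.neg.mul hq.snd.fst).add hq.snd.snd⟩
  map_add' b b' := by
    ext1
    obtain ⟨a, _, h⟩ := b.2
    obtain ⟨a', _, h'⟩ := b'.2
    simp only [Submodule.coe_add, ← h, ← h']
    refine congrArg _ (funext fun q => ?_)
    simp only [Function.comp_apply, Prod.fst_add, Prod.snd_add]
    ring
  map_smul' c b := by
    ext1
    obtain ⟨a, _, h⟩ := b.2
    simp only [Submodule.coe_smul, ← h]
    refine congrArg _ (funext fun q => ?_)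
    simp only [Function.comp_apply, Prod.smul_fst, Prod.smul_snd, smul_eq_mul,
      RingHom.id_apply]
    ring

/-- `cuspRestrict` as a linear map `θ(g) → 𝒪_{n-1}`, where `g` is the suspended cusp. -/
noncomputable def cuspFieldMap (𝕜 : Type*) [RCLike 𝕜] (m : ℕ) :
    (suspendedCusp 𝕜 m).fieldsAlong →ₗ[𝕜] smoothGerm 𝕜 (0 : (Fin m → 𝕜) × 𝕜) 𝕜 where
  toFun b := cuspRestrict 𝕜 m (b ())
  map_add' b b' := map_add (cuspRestrict 𝕜 m) (b ()) (b' ())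
  map_smul' c b := map_smul (cuspRestrict 𝕜 m) c (b ())

theorem coe_cuspRestrict
    (b : smoothGerm 𝕜 (0 : (Fin m → 𝕜) × 𝕜 × 𝕜) ((Fin m → 𝕜) × 𝕜 × 𝕜))
    (a : (Fin m → 𝕜) × 𝕜 × 𝕜 → (Fin m → 𝕜) × 𝕜 × 𝕜)
    (h : (a : Germ (𝓝 (0 : (Fin m → 𝕜) × 𝕜 × 𝕜)) ((Fin m → 𝕜) × 𝕜 × 𝕜)) = b) :
    (cuspRestrict 𝕜 m b : Germ (𝓝 (0 : (Fin m → 𝕜) × 𝕜)) 𝕜) =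
      (fun q => -q.2 * (a (cuspSingular 𝕜 m q)).2.1 + (a (cuspSingular 𝕜 m q)).2.2 :
        (Fin m → 𝕜) × 𝕜 → 𝕜) := by
  obtain ⟨b, hb⟩ := b
  subst h
  rfl

theorem coe_cuspFieldMap (b : (suspendedCusp 𝕜 m).fieldsAlong)
    (a : (Fin m → 𝕜) × 𝕜 × 𝕜 → (Fin m → 𝕜) × 𝕜 × 𝕜)
    (h : (a : Germ (𝓝 (0 : (Fin m → 𝕜) × 𝕜 × 𝕜)) ((Fin m → 𝕜) × 𝕜 × 𝕜)) = (b ()).1) :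
    (cuspFieldMap 𝕜 m b : Germ (𝓝 (0 : (Fin m → 𝕜) × 𝕜)) 𝕜) =
      (fun q => -q.2 * (a (cuspSingular 𝕜 m q)).2.1 + (a (cuspSingular 𝕜 m q)).2.2 :
        (Fin m → 𝕜) × 𝕜 → 𝕜) :=
  coe_cuspRestrict (b ()) a h

theorem cuspFieldMap_w (η : smoothGerm 𝕜 (0 : (Fin m → 𝕜) × 𝕜 × 𝕜) ((Fin m → 𝕜) × 𝕜 × 𝕜)) :
    cuspFieldMap 𝕜 m ((suspendedCusp 𝕜 m).w η) = cuspMap 𝕜 m η := by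
  ext1
  obtain ⟨_, a, ha, rfl⟩ := η
  refine (coe_cuspFieldMap _ (fun q => a ((suspendedCusp 𝕜 m).branch () q)) rfl).trans ?_
  simp only [suspendedCusp_branch_cuspSingular]
  rfl

/-- The last component of dg(v) is z v_{n-1} + (3z² + y) v_n, and 3z² + y vanishes on the singular
set. -/
theorem cuspFieldMap_t (χ : (suspendedCusp 𝕜 m).sourceFields) :
    cuspFieldMap 𝕜 m ((suspendedCusp 𝕜 m).t χ) = 0 := by
  ext1
  obtain ⟨a, _, h⟩ := (χ ()).2
  refine (coe_cuspFieldMap _ (fun q => fderiv 𝕜 ((suspendedCusp 𝕜 m).branch ()) q (a q)) ?_).trans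
    (congrArg _ (funext fun q => ?_))
  · simp only [MultiGerm.t, LinearMap.coe_mk, AddHom.coe_mk, ← h]
    rfl
  · simp only [fderiv_suspendedCusp_apply, cuspSingular]
    ring

theorem cuspFieldMap_surjective : Function.Surjective (cuspFieldMap 𝕜 m) := by
  rintro ⟨_, c, hc, rfl⟩
  have hs : SmoothNear 𝕜 (fun q : (Fin m → 𝕜) × 𝕜 × 𝕜 =>
      ((0, 0, c (q.1, q.2.2)) : (Fin m → 𝕜) × 𝕜 × 𝕜)) 0 := by
    have h1 : SmoothNear 𝕜 (fun q : (Fin m → 𝕜) × 𝕜 × 𝕜 => c (q.1, q.2.2)) 0 :=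
      SmoothNear.comp (f := fun q : (Fin m → 𝕜) × 𝕜 × 𝕜 => (q.1, q.2.2)) hc
        (SmoothNear.of_contDiff (by fun_prop) _)
    filter_upwards [h1] with q hq
    exact contDiffAt_const.prodMk (contDiffAt_const.prodMk hq)
  refine ⟨fun _ => ⟨_, _, hs, rfl⟩, ?_⟩
  ext1
  refine (coe_cuspFieldMap _ _ rfl).trans (congrArg _ (funext fun q => ?_))
  simp [cuspSingular]

/-- If b_n - z b_{n-1} vanishes on 3z² + y = 0, Hadamard's lemma divides it by 3z² + y. The quotient
is the last component of a source field whose other components are those of b. -/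
theorem ker_cuspFieldMap :
    LinearMap.ker (cuspFieldMap 𝕜 m) = LinearMap.range (suspendedCusp 𝕜 m).t := by
  refine le_antisymm (fun b hb => ?_) ?_
  · obtain ⟨a, ha, hab⟩ := (b ()).2
    change SmoothNear 𝕜 a (0 : (Fin m → 𝕜) × 𝕜 × 𝕜) at ha
    have hb0 : ∀ᶠ q in 𝓝 (0 : (Fin m → 𝕜) × 𝕜),
        -q.2 * (a (cuspSingular 𝕜 m q)).2.1 + (a (cuspSingular 𝕜 m q)).2.2 = 0 := by
      have h := congrArg Subtype.val (LinearMap.mem_ker.1 hb)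
      rw [coe_cuspFieldMap b a hab] at h
      exact Germ.coe_eq.1 h
    -- Coordinates ((x, z), s) with s = 3z² + y straighten the singular set to s = 0.
    let σ : ((Fin m → 𝕜) × 𝕜) × 𝕜 → (Fin m → 𝕜) × 𝕜 × 𝕜 :=
      fun p => (p.1.1, p.2 - 3 * p.1.2 ^ 2, p.1.2)
    let τ : (Fin m → 𝕜) × 𝕜 × 𝕜 → ((Fin m → 𝕜) × 𝕜) × 𝕜 :=
      fun q => ((q.1, q.2.2), 3 * q.2.2 ^ 2 + q.2.1)
    have hστ : ∀ q, σ (τ q) = q := fun q => by simp [σ, τ]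
    have hσ0 : σ 0 = 0 := by simp [σ]
    have hτ0 : τ 0 = 0 := by simp [τ]
    have hσ : ContDiff 𝕜 ∞ σ := by fun_prop
    have hτ : ContDiff 𝕜 ∞ τ := by fun_prop
    have haσ : SmoothNear 𝕜 (fun p => a (σ p)) 0 :=
      SmoothNear.comp (by rw [hσ0]; exact ha) (SmoothNear.of_contDiff hσ 0)
    have hh : SmoothNear 𝕜 (fun p => -p.1.2 * (a (σ p)).2.1 + (a (σ p)).2.2) 0 := by
      filter_upwards [haσ] with p hp
      exact (contDiffAt_fst.snd.neg.mul hp.snd.fst).add hp.snd.snd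
    obtain ⟨k, hk, hkeq⟩ := hh.exists_eq_snd_mul (by
      filter_upwards [hb0] with q hq
      simpa [σ, cuspSingular] using hq)
    have hkτ : SmoothNear 𝕜 (fun q => k (τ q)) 0 :=
      SmoothNear.comp (by rw [hτ0]; exact hk) (SmoothNear.of_contDiff hτ 0)
    have hχ : SmoothNear 𝕜 (fun q => ((a q).1, (a q).2.1, k (τ q)))
        (0 : (Fin m → 𝕜) × 𝕜 × 𝕜) := by
      filter_upwards [ha, hkτ] with q h1 h2
      exact h1.fst.prodMk (h1.snd.fst.prodMk h2)
    refine ⟨fun _ => ⟨_, _, hχ, rfl⟩, ?_⟩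
    have hτt : Tendsto τ (𝓝 0) (𝓝 0) := by
      have h := hτ.continuous.tendsto 0
      rwa [hτ0] at h
    ext ⟨⟩
    refine Eq.trans (Germ.coe_eq.2 ?_) hab
    filter_upwards [hτt.eventually hkeq] with q hq
    rw [hστ] at hq
    rw [fderiv_suspendedCusp_apply]
    refine Prod.ext rfl (Prod.ext rfl ?_)
    change q.2.2 * (a q).2.1 + (3 * q.2.2 ^ 2 + q.2.1) * k (τ q) = (a q).2.2
    change -q.2.2 * (a q).2.1 + (a q).2.2 = (3 * q.2.2 ^ 2 + q.2.1) * k (τ q) at hq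
    rw [← hq]
    ring
  · rintro _ ⟨χ, rfl⟩
    exact cuspFieldMap_t χ

end CuspTangent

/-! ### Reduction of a multigerm to one of its parts -/

namespace MultiGerm

variable {𝕜 : Type*} [RCLike 𝕜] {ι κ : Type} {E P : Type*}
  [NormedAddCommGroup E] [NormedSpace 𝕜 E] [NormedAddCommGroup P] [NormedSpace 𝕜 P]

/-- Extension by zero of a vector field along `g` to one along `{f, g}`. -/
def inrField (f : MultiGerm 𝕜 ι E P) (g : MultiGerm 𝕜 κ E P) :
    g.fieldsAlong →ₗ[𝕜] (f.union g).fieldsAlong where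
  toFun b := fun
    | .inl _ => 0
    | .inr j => b j
  map_add' b b' := by
    funext i
    rcases i with i | j
    · exact (add_zero _).symm
    · rfl
  map_smul' c b := by
    funext i
    rcases i with i | j
    · exact (smul_zero c).symm
    · rfl

theorem mem_tangentAe {f : MultiGerm 𝕜 ι E P} {b : f.fieldsAlong} :
    b ∈ f.tangentAe ↔ ∃ χ η, f.t χ + f.w η = b := by
  simp only [tangentAe, Submodule.mem_sup, LinearMap.mem_range, exists_exists_eq_and]

/-- Source fields are independent on each branch but η is shared: vanishing on the branches of `f`
says precisely that η lifts over `f`, by minus the source field. -/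
theorem inrField_mem_tangentAe_iff {f : MultiGerm 𝕜 ι E P} {g : MultiGerm 𝕜 κ E P}
    {b : g.fieldsAlong} :
    f.inrField g b ∈ (f.union g).tangentAe ↔ ∃ χ, ∃ η ∈ f.liftable, g.t χ + g.w η = b := by
  rw [mem_tangentAe]
  constructor
  · rintro ⟨χ, η, h⟩
    let ξ : f.sourceFields := fun i => χ (.inl i)
    refine ⟨fun j => χ (.inr j), η, ⟨-ξ, ?_⟩, ?_⟩
    · rw [map_neg, neg_eq_iff_add_eq_zero]
      exact funext fun i => congrFun h (.inl i)
    · exact funext fun j => congrFun h (.inr j)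
  · rintro ⟨χ, η, ⟨ξ, hξ⟩, h⟩
    refine ⟨fun | .inl i => (-ξ) i | .inr j => χ j, η, ?_⟩
    funext i
    rcases i with i | j
    · have h1 : f.t (-ξ) + f.w η = 0 := by rw [map_neg, hξ, neg_add_cancel]
      exact congrFun h1 i
    · exact congrFun h j

/-- Writing the `f`-part of a field as tf(χ) + wf(η) and subtracting this tangent vector clears that
part, at the cost of subtracting wg(η) on `g`. -/
theorem IsStable.mkQ_inrField_surjective {f : MultiGerm 𝕜 ι E P} (hf : f.IsStable)
    (g : MultiGerm 𝕜 κ E P) :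
    Function.Surjective ((f.union g).tangentAe.mkQ ∘ₗ f.inrField g) := by
  intro y
  obtain ⟨c, rfl⟩ := Submodule.mkQ_surjective _ y
  let c₁ : f.fieldsAlong := fun i => c (.inl i)
  let c₂ : g.fieldsAlong := fun j => c (.inr j)
  obtain ⟨χ, η, h⟩ := mem_tangentAe.1 (show c₁ ∈ f.tangentAe from hf.symm ▸ Submodule.mem_top)
  refine ⟨c₂ - g.w η, ?_⟩
  rw [LinearMap.comp_apply, ← sub_eq_zero, ← map_sub, Submodule.mkQ_apply,
    Submodule.Quotient.mk_eq_zero, mem_tangentAe]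
  refine ⟨fun | .inl i => (-χ) i | .inr j => (0 : g.sourceFields) j, -η, ?_⟩
  funext i
  rcases i with i | j
  · have h1 : f.t (-χ) + f.w (-η) = 0 - c₁ := by
      rw [map_neg, map_neg, ← h]
      abel
    exact congrFun h1 i
  · have h1 : g.t 0 + g.w (-η) = (c₂ - g.w η) - c₂ := by
      rw [map_zero, map_neg]
      abel
    exact congrFun h1 j

end MultiGerm

theorem mainTheorem3 {𝕜 : Type*} [RCLike 𝕜] {ι : Type} [Finite ι] (n : ℕ) (hn : 3 ≤ n)
    (f : MultiGerm 𝕜 ι (Fin (n - 2) → 𝕜) (Fin (n - 2) → 𝕜))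
    (F : MultiGerm 𝕜 ι ((Fin (n - 2) → 𝕜) × 𝕜 × 𝕜) ((Fin (n - 2) → 𝕜) × 𝕜 × 𝕜))
    (hF : F.IsUnfoldingOf f) (hstable : F.IsStable) :
    (F.union (suspendedCusp 𝕜 (n - 2))).codimAe =
      Module.rank 𝕜 (smoothGerm 𝕜 (0 : (Fin (n - 2) → 𝕜) × 𝕜) 𝕜 ⧸
        F.liftable.map (cuspMap 𝕜 (n - 2))) := by
  set g := suspendedCusp 𝕜 (n - 2)
  set Φ := (F.liftable.map (cuspMap 𝕜 (n - 2))).mkQ ∘ₗ cuspFieldMap 𝕜 (n - 2)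
  set Ψ := (F.union g).tangentAe.mkQ ∘ₗ F.inrField g
  have hΦ : Function.Surjective Φ :=
    (Submodule.mkQ_surjective _).comp cuspFieldMap_surjective
  have hΨ : Function.Surjective Ψ := hstable.mkQ_inrField_surjective g
  -- Both kernels are tg(θ_n) + wg(Lift(F)).
  have hker : LinearMap.ker Ψ = LinearMap.ker Φ := by
    ext b
    simp only [Φ, Ψ, LinearMap.mem_ker, LinearMap.comp_apply, Submodule.mkQ_apply,
      Submodule.Quotient.mk_eq_zero, MultiGerm.inrField_mem_tangentAe_iff, Submodule.mem_map]
    constructor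
    · rintro ⟨χ, η, hη, rfl⟩
      exact ⟨η, hη, by rw [map_add, cuspFieldMap_t, cuspFieldMap_w, zero_add]⟩
    · rintro ⟨η, hη, h⟩
      have hb : b - g.w η ∈ LinearMap.ker (cuspFieldMap 𝕜 (n - 2)) := by
        rw [LinearMap.mem_ker, map_sub, cuspFieldMap_w, h, sub_self]
      rw [ker_cuspFieldMap] at hb
      obtain ⟨χ, hχ⟩ := hb
      exact ⟨χ, η, hη, by rw [hχ, sub_add_cancel]⟩
  exact ((Ψ.quotKerEquivOfSurjective hΨ).symm ≪≫ₗ Submodule.quotEquivOfEq _ _ hker ≪≫ₗ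
    Φ.quotKerEquivOfSurjective hΦ).rank_eq
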